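/- Let $M$ be a smooth $n$-manifold, $\psi=(\psi_1,\dots,\psi_{n+1}):M\to\mathbb R^{n+1}$ a smooth immersion and $\nu$ a smooth unit normal vector field along $\psi$. In local coordinates $x_1,\dots,x_n$ let $g_{ij}=\langle\partial_i\psi,\partial_j\psi\rangle$ be the induced metric, $A_{ij}=\langle\partial_i\partial_j\psi,\nu\rangle$ the second fundamental form and $A=(A^i_j)$, $A^i_j=g^{ik}A_{kj}$, the shape operator; a comma denotes covariant differentiation with respect to the Levi-Civita connection of $g$. Let $\mu_0\in\mathbb R$ be a constant and $r\ge 0$ an integer. With $\sigma_k$ the $k$-th elementary symmetric function of the eigenvalues of $A$ (so $\sigma_0=1$ and $\sigma_k=0$ for $k>n$), put $$\sigma_r^\infty=\sum_{j=0}^{r}\frac{\mu_0^j}{j!}\,\sigma_{r-j},\qquad T_r^\infty=\sum_{j=0}^{r}(-1)^j\sigma_{r-j}^\infty A^j,\qquad (T_r^\infty)^{ij}=(T_r^\infty)^i_k\,g^{kj}.$$ The hypersurface is called $\sigma_r^\infty$-minimal if $(r+1)\sigma_{r+1}^\infty-\mu_0\sigma_r^\infty$ vanishes identically on $M$. Then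 the following are equivalent: 1. the hypersurface is $\sigma_r^\infty$-minimal; 2. every component $\psi_a$ of the position vector satisfies $(T_r^\infty)^{ij}\psi_{a,ij}=0$ on $M$; 3. every component $\psi_a$ satisfies the divergence-form equation $\big((T_r^\infty)^{ij}\psi_{a,i}\big)_{,j}=0$ on $M$. Moreover, the tensor $(T_r^\infty)^{ij}$ is divergence-free: $(T_r^\infty)^{ij}{}_{,j}=0$. -/

import Mathlib

open scoped Manifold ContDiff

noncomputable section

namespace WeightedCurvature

/-! ### Weighted symmetric functions and weighted Newton transformations of a matrix -/

/-- The `k`-th elementary symmetric function `σ_k` of the (real) eigenvalues of `A`,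
listed with algebraic multiplicity. -/
def sigma {n : ℕ} (A : Matrix (Fin n) (Fin n) ℝ) (k : ℕ) : ℝ :=
  A.charpoly.roots.esymm k

/-- The weighted elementary symmetric polynomial
`σ_r^∞(μ₀, A) = ∑_{j=0}^r μ₀^j / j! · σ_{r-j}(A)`. -/
def wsigma {n : ℕ} (μ₀ : ℝ) (A : Matrix (Fin n) (Fin n) ℝ) (r : ℕ) : ℝ :=
  ∑ j ∈ Finset.range (r + 1), μ₀ ^ j / (j.factorial : ℝ) * sigma A (r - j)

/-- The weighted Newton transformation
`T_r^∞(μ₀, A) = ∑_{j=0}^r (-1)^j σ_{r-j}^∞(μ₀, A) A^j`. -/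
def wNewton {n : ℕ} (μ₀ : ℝ) (A : Matrix (Fin n) (Fin n) ℝ) (r : ℕ) :
    Matrix (Fin n) (Fin n) ℝ :=
  ∑ j ∈ Finset.range (r + 1), ((-1) ^ j * wsigma μ₀ A (r - j)) • A ^ j

/-! ### Tensor calculus in a coordinate domain of `ℝⁿ` -/

/-- The partial derivative `∂f/∂x_i` at `u`. -/
def pd {n : ℕ} {F : Type*} [NormedAddCommGroup F] [NormedSpace ℝ F]
    (i : Fin n) (f : EuclideanSpace ℝ (Fin n) → F) (u : EuclideanSpace ℝ (Fin n)) : F :=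
  fderiv ℝ f u (EuclideanSpace.single i 1)

/-- The Christoffel symbol `Γ^k_{ij}` of the Levi-Civita connection of the metric `g_{ij}`. -/
def christoffel {n : ℕ} (g : EuclideanSpace ℝ (Fin n) → Matrix (Fin n) (Fin n) ℝ)
    (k i j : Fin n) (u : EuclideanSpace ℝ (Fin n)) : ℝ :=
  (1 / 2) * ∑ l, (g u)⁻¹ k l *
    (pd i (fun v => g v j l) u + pd j (fun v => g v i l) u - pd l (fun v => g v i j) u)

/-- The second covariant derivative `f_{,ij} = ∂²f/∂x_i∂x_j - Γ^k_{ij} ∂f/∂x_k`. -/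
def covHess {n : ℕ} (g : EuclideanSpace ℝ (Fin n) → Matrix (Fin n) (Fin n) ℝ)
    (f : EuclideanSpace ℝ (Fin n) → ℝ) (i j : Fin n) (u : EuclideanSpace ℝ (Fin n)) : ℝ :=
  pd i (pd j f) u - ∑ k, christoffel g k i j u * pd k f u

/-- The divergence `X^j_{,j} = ∂X^j/∂x_j + Γ^j_{jk} X^k` of a vector field. -/
def covDiv {n : ℕ} (g : EuclideanSpace ℝ (Fin n) → Matrix (Fin n) (Fin n) ℝ)
    (X : EuclideanSpace ℝ (Fin n) → Fin n → ℝ) (u : EuclideanSpace ℝ (Fin n)) : ℝ :=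
  ∑ j, pd j (fun v => X v j) u + ∑ j, ∑ k, christoffel g j j k u * X u k

/-- The divergence `T^{ij}_{,j} = ∂T^{ij}/∂x_j + Γ^i_{jk} T^{kj} + Γ^j_{jk} T^{ik}` of a
contravariant 2-tensor. -/
def covDivTensor {n : ℕ} (g : EuclideanSpace ℝ (Fin n) → Matrix (Fin n) (Fin n) ℝ)
    (T : EuclideanSpace ℝ (Fin n) → Matrix (Fin n) (Fin n) ℝ)
    (i : Fin n) (u : EuclideanSpace ℝ (Fin n)) : ℝ :=
  ∑ j, pd j (fun v => T v i j) u + ∑ j, ∑ k, christoffel g i j k u * T u k j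
    + ∑ j, ∑ k, christoffel g j j k u * T u i k

/-! ### A parametrized hypersurface `φ` in `ℝⁿ⁺¹` with unit normal `N` -/

/-- The induced metric `g_{ij} = ⟨∂_i φ, ∂_j φ⟩`. -/
def metric {n : ℕ} (φ : EuclideanSpace ℝ (Fin n) → EuclideanSpace ℝ (Fin (n + 1)))
    (u : EuclideanSpace ℝ (Fin n)) : Matrix (Fin n) (Fin n) ℝ :=
  Matrix.of fun i j => inner ℝ (pd i φ u) (pd j φ u)

/-- The second fundamental form `A_{ij} = ⟨∂_i ∂_j φ, N⟩`. -/
def secondForm {n : ℕ} (φ N : EuclideanSpace ℝ (Fin n) → EuclideanSpace ℝ (Fin (n + 1)))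
    (u : EuclideanSpace ℝ (Fin n)) : Matrix (Fin n) (Fin n) ℝ :=
  Matrix.of fun i j => inner ℝ (pd i (pd j φ) u) (N u)

/-- The shape operator `A^i_j = g^{ik} A_{kj}` (row index up, column index down). -/
def shape {n : ℕ} (φ N : EuclideanSpace ℝ (Fin n) → EuclideanSpace ℝ (Fin (n + 1)))
    (u : EuclideanSpace ℝ (Fin n)) : Matrix (Fin n) (Fin n) ℝ :=
  (metric φ u)⁻¹ * secondForm φ N u

/-- The weighted Newton tensor with raised index, `(T_r^∞)^{ij} = (T_r^∞)^i_k g^{kj}`. -/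
def newtonUp {n : ℕ} (μ₀ : ℝ) (r : ℕ)
    (φ N : EuclideanSpace ℝ (Fin n) → EuclideanSpace ℝ (Fin (n + 1)))
    (u : EuclideanSpace ℝ (Fin n)) : Matrix (Fin n) (Fin n) ℝ :=
  wNewton μ₀ (shape φ N u) r * (metric φ u)⁻¹

/-! ### Hypersurfaces `ψ : M → ℝⁿ⁺¹` with unit normal field `ν`

All quantities below are scalars or tensors on `M`; they are expressed in the coordinates of an
arbitrary smooth chart `e` of `M`, in which `ψ` and `ν` read `ψ ∘ e.symm` and `ν ∘ e.symm`. -/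

section Hypersurface

variable {n : ℕ} {M : Type*} [TopologicalSpace M] [ChartedSpace (EuclideanSpace ℝ (Fin n)) M]

/-- `ψ` is a smooth immersion of `M` as a hypersurface of `ℝⁿ⁺¹`, and `ν` is a smooth unit
normal vector field along it. -/
structure IsHypersurface (ψ ν : M → EuclideanSpace ℝ (Fin (n + 1))) : Prop where
  smooth : ContMDiff (𝓡 n) (𝓡 (n + 1)) ∞ ψ
  immersion : ∀ p, Function.Injective (mfderiv (𝓡 n) (𝓡 (n + 1)) ψ p)
  normal_smooth : ContMDiff (𝓡 n) (𝓡 (n + 1)) ∞ ν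
  normal_unit : ∀ p, ‖ν p‖ = 1
  normal_orthogonal : ∀ (p : M) (v : TangentSpace (𝓡 n) p),
    inner (E := EuclideanSpace ℝ (Fin (n + 1))) ℝ (mfderiv (𝓡 n) (𝓡 (n + 1)) ψ p v) (ν p) = 0

/-- `σ_r^∞`-minimality: `(r+1) σ_{r+1}^∞ - μ₀ σ_r^∞` vanishes identically on `M`. -/
def IsSigmaMinimal (μ₀ : ℝ) (r : ℕ) (ψ ν : M → EuclideanSpace ℝ (Fin (n + 1))) : Prop :=
  ∀ e ∈ IsManifold.maximalAtlas (𝓡 n) ∞ M, ∀ u ∈ e.target,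
    ((r : ℝ) + 1) * wsigma μ₀ (shape (ψ ∘ e.symm) (ν ∘ e.symm) u) (r + 1)
      - μ₀ * wsigma μ₀ (shape (ψ ∘ e.symm) (ν ∘ e.symm) u) r = 0

/-- The function `f` on `M` solves `(T_r^∞)^{ij} f_{,ij} = 0`. -/
def SolvesNewtonPDE (μ₀ : ℝ) (r : ℕ) (ψ ν : M → EuclideanSpace ℝ (Fin (n + 1)))
    (f : M → ℝ) : Prop :=
  ∀ e ∈ IsManifold.maximalAtlas (𝓡 n) ∞ M, ∀ u ∈ e.target,
    ∑ i, ∑ j, newtonUp μ₀ r (ψ ∘ e.symm) (ν ∘ e.symm) u i j *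
      covHess (metric (ψ ∘ e.symm)) (f ∘ e.symm) i j u = 0

/-- The function `f` on `M` solves `((T_r^∞)^{ij} f_{,i})_{,j} = 0`. -/
def SolvesNewtonDivPDE (μ₀ : ℝ) (r : ℕ) (ψ ν : M → EuclideanSpace ℝ (Fin (n + 1)))
    (f : M → ℝ) : Prop :=
  ∀ e ∈ IsManifold.maximalAtlas (𝓡 n) ∞ M, ∀ u ∈ e.target,
    covDiv (metric (ψ ∘ e.symm))
      (fun v j => ∑ i, newtonUp μ₀ r (ψ ∘ e.symm) (ν ∘ e.symm) v i j * pd i (f ∘ e.symm) v) u = 0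

/-- The weighted Newton tensor is divergence-free: `(T_r^∞)^{ij}_{,j} = 0`. -/
def NewtonDivFree (μ₀ : ℝ) (r : ℕ) (ψ ν : M → EuclideanSpace ℝ (Fin (n + 1))) : Prop :=
  ∀ e ∈ IsManifold.maximalAtlas (𝓡 n) ∞ M, ∀ u ∈ e.target, ∀ i,
    covDivTensor (metric (ψ ∘ e.symm)) (newtonUp μ₀ r (ψ ∘ e.symm) (ν ∘ e.symm)) i u = 0

end Hypersurface

end WeightedCurvature

end

/-!
By the Gauss formula the Hessian of `ψ_a` is `A_{ij} ν_a`, so contracting it with `T_r^∞` gives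
`tr (T_r^∞ A) ν_a = ((r+1) σ_{r+1}^∞ - μ₀ σ_r^∞) ν_a`. Since `ν` never vanishes, this yields the
equivalence with the equation in non-divergence form, and the divergence form agrees with it
because `T_r^∞` is divergence-free.

The shape operator is diagonalizable, being self-adjoint for the induced metric, so Newton's
identities say that the generating function `s(t) = ∑ σ_r^∞ tʳ` solves `s' = s (tr ((1 + t A)⁻¹ A)
+ μ₀)`. As `∑ T_r^∞ tʳ = s(t) (1 + t A)⁻¹`, comparing coefficients gives the trace formula above,
while differentiating the equation along `M` gives `∂_j σ_{r+1}^∞ = tr (T_r^∞ ∇_j A)`. The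
divergence of `T_{r+1}^∞ = σ_{r+1}^∞ - A T_r^∞` then vanishes by induction on `r`: the derivative
of `σ_{r+1}^∞` cancels that of the factor `A` by Codazzi's equation.
-/

noncomputable section

namespace WeightedCurvature

open Matrix PowerSeries Finset

/-! ### Newton's identities for diagonalizable matrices -/

section Algebra

theorem succ_mul_esymm_succ {ι R : Type*} [Fintype ι] [CommRing R] (d : ι → R) (k : ℕ) :
    ((k : R) + 1) * ((univ : Finset ι).val.map d).esymm (k + 1) =
      ∑ a ∈ antidiagonal k, ((univ : Finset ι).val.map d).esymm a.1 *
        ((-1) ^ a.2 * ∑ i, d i ^ (a.2 + 1)) := by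
  classical
  have newton := congrArg (MvPolynomial.aeval d) (MvPolynomial.mul_esymm_eq_sum ι R (k + 1))
  simp only [map_mul, map_sum, map_pow, map_neg, map_one, map_natCast, MvPolynomial.psum,
    MvPolynomial.aeval_esymm_eq_multiset_esymm, MvPolynomial.aeval_X] at newton
  rw [← Nat.cast_succ, newton, sum_filter, Nat.sum_antidiagonal_succ', if_neg (lt_irrefl _),
    zero_add, mul_sum]
  refine sum_congr rfl fun a ha => ?_
  obtain rfl : a.1 + a.2 = k := mem_antidiagonal.mp ha
  have sign : (-1 : R) ^ (a.1 + a.2 + 1 + 1) * (-1) ^ a.1 = (-1) ^ a.2 := by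
    rw [← pow_add, show a.1 + a.2 + 1 + 1 + a.1 = 2 * (a.1 + 1) + a.2 by ring, pow_add, pow_mul]
    simp
  rw [if_pos (by omega), ← sign]
  ring

variable {ι K : Type*} [Fintype ι] [DecidableEq ι] [CommRing K]

/-- Diagonalizability over the coefficient ring. For shape operators it guarantees that all
eigenvalues are real, so that `sigma`, which only sees real eigenvalues, satisfies Newton's
identities. -/
def IsDiagonalizable (A : Matrix ι ι K) : Prop :=
  ∃ (P : (Matrix ι ι K)ˣ) (d : ι → K), A = P.val * diagonal d * P⁻¹.val

theorem trace_units_conj_diagonal_pow (P : (Matrix ι ι K)ˣ) (d : ι → K) (k : ℕ) :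
    ((P.val * diagonal d * P⁻¹.val) ^ k).trace = ∑ i, d i ^ k := by
  rw [Units.conj_pow, trace_mul_cycle, Units.inv_mul, one_mul, diagonal_pow, trace_diagonal]
  rfl

theorem IsDiagonalizable.units_conj {A : Matrix ι ι K} (hA : IsDiagonalizable A)
    (Q : (Matrix ι ι K)ˣ) : IsDiagonalizable (Q.val * A * Q⁻¹.val) := by
  obtain ⟨P, d, rfl⟩ := hA
  exact ⟨Q * P, d, by simp only [Units.val_mul, _root_.mul_inv_rev, mul_assoc]⟩

theorem isDiagonalizable_of_isHermitian {A : Matrix ι ι ℝ} (hA : A.IsHermitian) :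
    IsDiagonalizable A :=
  ⟨Unitary.toUnits hA.eigenvectorUnitary, hA.eigenvalues, by
    conv_lhs => rw [hA.spectral_theorem, Unitary.conjStarAlgAut_apply]
    rfl⟩

/-- With `g = Bᵀ B`, the matrix `g⁻¹ S` is conjugate by `B` to the symmetric `B⁻ᵀ S B⁻¹`. -/
theorem isDiagonalizable_inv_mul {g S : Matrix ι ι ℝ} (hg : g.PosDef) (hS : S.IsHermitian) :
    IsDiagonalizable (g⁻¹ * S) := by
  obtain ⟨B, rfl⟩ : ∃ B : Matrix ι ι ℝ, g = Bᴴ * B := by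
    open scoped MatrixOrder in
    exact CStarAlgebra.nonneg_iff_eq_star_mul_self.mp hg.posSemidef.nonneg
  have hB : IsUnit B.det := by
    have hBB := (isUnit_iff_isUnit_det _).mp hg.isUnit
    rw [det_mul] at hBB
    exact isUnit_of_mul_isUnit_right hBB
  have hconj : (Bᴴ * B)⁻¹ * S = B⁻¹ * ((B⁻¹)ᴴ * S * B⁻¹) * B := by
    rw [Matrix.mul_inv_rev, conjTranspose_nonsing_inv]
    simp only [mul_assoc]
    rw [nonsing_inv_mul _ hB, mul_one]
  rw [hconj]
  exact (isDiagonalizable_of_isHermitian (isHermitian_conjTranspose_mul_mul _ hS)).units_conj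
    (nonsingInvUnit B hB)⁻¹

variable {n : ℕ} {A : Matrix (Fin n) (Fin n) ℝ}

theorem sigma_units_conj_diagonal (P : (Matrix (Fin n) (Fin n) ℝ)ˣ) (d : Fin n → ℝ) (k : ℕ) :
    sigma (P.val * diagonal d * P⁻¹.val) k = ((univ : Finset (Fin n)).val.map d).esymm k := by
  have hroots : (∏ i, (Polynomial.X - Polynomial.C (d i))).roots = univ.val.map d := by
    rw [← Polynomial.roots_multiset_prod_X_sub_C (univ.val.map d), Multiset.map_map]
    rfl
  rw [sigma, coe_units_inv, charpoly_units_conj, charpoly_diagonal, hroots]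

/-- The formal power series `tr ((1 + t A)⁻¹ B) = ∑ (-1)ᵏ tr (Aᵏ B) tᵏ`. For `B = A` its
coefficients are the signed power sums of the eigenvalues of `A`. -/
def traceSeries (A B : Matrix ι ι K) : K⟦X⟧ :=
  PowerSeries.mk fun k => (-1) ^ k * (A ^ k * B).trace

theorem IsDiagonalizable.derivative_sigmaSeries (hA : IsDiagonalizable A) :
    d⁄dX ℝ (PowerSeries.mk (sigma A)) = PowerSeries.mk (sigma A) * traceSeries A A := by
  obtain ⟨P, d, rfl⟩ := hA
  ext k
  simp only [coeff_derivative, PowerSeries.coeff_mul, traceSeries, coeff_mk, ← pow_succ,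
    sigma_units_conj_diagonal, trace_units_conj_diagonal_pow, ← succ_mul_esymm_succ, mul_comm]

end Algebra

/-! ### Weighted symmetric functions and Newton transformations -/

section Weighted

theorem derivative_rescale {R : Type*} [CommRing R] (a : R) (f : R⟦X⟧) :
    d⁄dX R (rescale a f) = PowerSeries.C a * rescale a (d⁄dX R f) := by
  ext k
  simp only [coeff_derivative, coeff_rescale, PowerSeries.coeff_C_mul]
  ring

variable {n : ℕ} {A : Matrix (Fin n) (Fin n) ℝ}

/-- The generating function `∑ σ_r^∞ tʳ`. -/
def wsigmaSeries (μ₀ : ℝ) (A : Matrix (Fin n) (Fin n) ℝ) : ℝ⟦X⟧ :=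
  PowerSeries.mk (wsigma μ₀ A)

theorem wsigmaSeries_eq_rescale_exp_mul (μ₀ : ℝ) (A : Matrix (Fin n) (Fin n) ℝ) :
    wsigmaSeries μ₀ A = rescale μ₀ (PowerSeries.exp ℝ) * PowerSeries.mk (sigma A) := by
  ext r
  simp only [wsigmaSeries, coeff_mk, wsigma, PowerSeries.coeff_mul, coeff_rescale, coeff_exp,
    Nat.sum_antidiagonal_eq_sum_range_succ_mk]
  exact sum_congr rfl fun j _ => by simp [div_eq_mul_inv]

theorem IsDiagonalizable.derivative_wsigmaSeries (hA : IsDiagonalizable A) (μ₀ : ℝ) :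
    d⁄dX ℝ (wsigmaSeries μ₀ A) =
      wsigmaSeries μ₀ A * (traceSeries A A + PowerSeries.C μ₀) := by
  rw [wsigmaSeries_eq_rescale_exp_mul, Derivation.leibniz, derivative_rescale, derivative_exp,
    hA.derivative_sigmaSeries]
  simp only [smul_eq_mul]
  ring

theorem wsigma_zero (μ₀ : ℝ) (A : Matrix (Fin n) (Fin n) ℝ) : wsigma μ₀ A 0 = 1 := by
  simp [wsigma, sigma, Multiset.esymm]

theorem wNewton_zero (μ₀ : ℝ) (A : Matrix (Fin n) (Fin n) ℝ) : wNewton μ₀ A 0 = 1 := by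
  simp [wNewton, wsigma_zero]

theorem wNewton_succ (μ₀ : ℝ) (A : Matrix (Fin n) (Fin n) ℝ) (r : ℕ) :
    wNewton μ₀ A (r + 1) = wsigma μ₀ A (r + 1) • 1 - A * wNewton μ₀ A r := by
  rw [wNewton, sum_range_succ', add_comm, sub_eq_add_neg, wNewton, mul_sum, ← sum_neg_distrib]
  simp only [pow_zero, one_mul, Nat.sub_zero, Nat.add_sub_add_right, mul_smul_comm, pow_succ' A,
    pow_succ' (-1 : ℝ), neg_mul, neg_smul]

theorem wNewton_commute (μ₀ : ℝ) (A : Matrix (Fin n) (Fin n) ℝ) (r : ℕ) :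
    Commute (wNewton μ₀ A r) A :=
  Commute.sum_left _ _ _ fun j _ => ((Commute.refl A).pow_left j).smul_left _

/-- The generating function of `T_r^∞` is `(∑ σ_r^∞ tʳ) (1 + t A)⁻¹`. -/
theorem coeff_wsigmaSeries_mul_traceSeries (μ₀ : ℝ) (A B : Matrix (Fin n) (Fin n) ℝ) (r : ℕ) :
    PowerSeries.coeff r (wsigmaSeries μ₀ A * traceSeries A B) = (wNewton μ₀ A r * B).trace := by
  rw [mul_comm, PowerSeries.coeff_mul, Nat.sum_antidiagonal_eq_sum_range_succ_mk, wNewton, sum_mul,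
    trace_sum]
  refine sum_congr rfl fun j _ => ?_
  simp only [traceSeries, wsigmaSeries, coeff_mk, Matrix.smul_mul, trace_smul, smul_eq_mul]
  ring

theorem IsDiagonalizable.trace_wNewton_mul_self (hA : IsDiagonalizable A) (μ₀ : ℝ) (r : ℕ) :
    (wNewton μ₀ A r * A).trace =
      ((r : ℝ) + 1) * wsigma μ₀ A (r + 1) - μ₀ * wsigma μ₀ A r := by
  have hcoeff := congrArg (PowerSeries.coeff r) (hA.derivative_wsigmaSeries μ₀)
  rw [coeff_derivative, mul_add (wsigmaSeries μ₀ A), map_add, PowerSeries.coeff_mul_C,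
    coeff_wsigmaSeries_mul_traceSeries] at hcoeff
  simp only [wsigmaSeries, coeff_mk] at hcoeff
  linarith

end Weighted

/-! ### Partial derivatives -/

section PartialDerivatives

open Filter Topology

variable {n : ℕ} {F : Type*} [NormedAddCommGroup F] [NormedSpace ℝ F]
  {u : EuclideanSpace ℝ (Fin n)}

theorem pd_congr (j : Fin n) {f h : EuclideanSpace ℝ (Fin n) → F} (hfh : f =ᶠ[𝓝 u] h) :
    pd j f u = pd j h u := by
  rw [pd, pd, hfh.fderiv_eq]

theorem pd_const (j : Fin n) (c : F) : pd j (fun _ => c) u = 0 := by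
  simp [pd]

theorem pd_sub (j : Fin n) {f h : EuclideanSpace ℝ (Fin n) → F} (hf : DifferentiableAt ℝ f u)
    (hh : DifferentiableAt ℝ h u) : pd j (fun v => f v - h v) u = pd j f u - pd j h u := by
  rw [pd, fderiv_fun_sub hf hh]
  rfl

theorem pd_sum (j : Fin n) {ι : Type*} (s : Finset ι) {f : ι → EuclideanSpace ℝ (Fin n) → F}
    (hf : ∀ i ∈ s, DifferentiableAt ℝ (f i) u) :
    pd j (fun v => ∑ i ∈ s, f i v) u = ∑ i ∈ s, pd j (f i) u := by
  rw [pd, fderiv_fun_sum hf, _root_.sum_apply]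
  rfl

theorem pd_smul (j : Fin n) {f : EuclideanSpace ℝ (Fin n) → ℝ}
    {h : EuclideanSpace ℝ (Fin n) → F} (hf : DifferentiableAt ℝ f u)
    (hh : DifferentiableAt ℝ h u) :
    pd j (fun v => f v • h v) u = f u • pd j h u + pd j f u • h u := by
  rw [pd, fderiv_fun_smul hf hh]
  rfl

theorem pd_mul (j : Fin n) {𝔸 : Type*} [NormedRing 𝔸] [NormedAlgebra ℝ 𝔸]
    {f h : EuclideanSpace ℝ (Fin n) → 𝔸} (hf : DifferentiableAt ℝ f u)
    (hh : DifferentiableAt ℝ h u) :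
    pd j (fun v => f v * h v) u = pd j f u * h u + f u * pd j h u := by
  rw [pd, fderiv_fun_mul' hf hh, add_comm]
  rfl

theorem pd_linearMap_apply (j : Fin n) {G : Type*} [NormedAddCommGroup G] [NormedSpace ℝ G]
    [FiniteDimensional ℝ F] (L : F →ₗ[ℝ] G) {f : EuclideanSpace ℝ (Fin n) → F}
    (hf : DifferentiableAt ℝ f u) : pd j (fun v => L (f v)) u = L (pd j f u) := by
  change fderiv ℝ (LinearMap.toContinuousLinearMap L ∘ f) u _ = _
  rw [(L.toContinuousLinearMap.hasFDerivAt.comp u hf.hasFDerivAt).fderiv]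
  rfl

theorem pd_inner (j : Fin n) {E : Type*} [NormedAddCommGroup E] [InnerProductSpace ℝ E]
    {f h : EuclideanSpace ℝ (Fin n) → E} (hf : DifferentiableAt ℝ f u)
    (hh : DifferentiableAt ℝ h u) :
    pd j (fun v => inner ℝ (f v) (h v)) u =
      inner ℝ (pd j f u) (h u) + inner ℝ (f u) (pd j h u) := by
  rw [pd, fderiv_inner_apply ℝ hf hh, add_comm]
  rfl

theorem contDiffAt_pd {f : EuclideanSpace ℝ (Fin n) → F} {k m : WithTop ℕ∞}
    (hf : ContDiffAt ℝ k f u) (j : Fin n) (hmk : m + 1 ≤ k) : ContDiffAt ℝ m (pd j f) u :=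
  (hf.fderiv_right hmk).clm_apply contDiffAt_const

theorem pd_comm {f : EuclideanSpace ℝ (Fin n) → F} (hf : ContDiffAt ℝ 2 f u) (i j : Fin n) :
    pd i (pd j f) u = pd j (pd i f) u := by
  have hdiff : DifferentiableAt ℝ (fderiv ℝ f) u :=
    (hf.fderiv_right (m := 1) (by norm_num)).differentiableAt (by norm_num)
  have hsecond : ∀ i j : Fin n, pd i (pd j f) u =
      fderiv ℝ (fderiv ℝ f) u (EuclideanSpace.single i 1) (EuclideanSpace.single j 1) := by
    intro i j
    change fderiv ℝ (fun v => fderiv ℝ f v (EuclideanSpace.single j 1)) u _ = _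
    rw [fderiv_clm_apply hdiff (differentiableAt_const _)]
    simp
  rw [hsecond, hsecond]
  exact (hf.isSymmSndFDerivAt (by simp)).eq _ _

end PartialDerivatives

section MatrixDerivatives

open scoped Matrix.Norms.Operator

variable {n m : ℕ} {u : EuclideanSpace ℝ (Fin n)}
  {B : EuclideanSpace ℝ (Fin n) → Matrix (Fin m) (Fin m) ℝ}

theorem differentiableAt_matrix_of_apply
    (hB : ∀ a b, DifferentiableAt ℝ (fun v => B v a b) u) : DifferentiableAt ℝ B u := by
  have hsum : B = fun v => ∑ a, ∑ b, B v a b • Matrix.single a b (1 : ℝ) := by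
    ext1 v
    conv_lhs => rw [Matrix.matrix_eq_sum_single (B v)]
    simp only [Matrix.smul_single, smul_eq_mul, mul_one]
  rw [hsum]
  exact DifferentiableAt.fun_sum fun a _ => DifferentiableAt.fun_sum fun b _ =>
    (hB a b).smul_const _

theorem differentiableAt_linearMap_apply {G : Type*} [NormedAddCommGroup G] [NormedSpace ℝ G]
    (L : Matrix (Fin m) (Fin m) ℝ →ₗ[ℝ] G) (hB : DifferentiableAt ℝ B u) :
    DifferentiableAt ℝ (fun v => L (B v)) u :=
  L.toContinuousLinearMap.differentiableAt.comp u hB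

theorem differentiableAt_matrix_apply (hB : DifferentiableAt ℝ B u) (a b : Fin m) :
    DifferentiableAt ℝ (fun v => B v a b) u :=
  differentiableAt_linearMap_apply (Matrix.entryLinearMap ℝ ℝ a b) hB

theorem differentiableAt_trace (hB : DifferentiableAt ℝ B u) :
    DifferentiableAt ℝ (fun v => (B v).trace) u :=
  differentiableAt_linearMap_apply (Matrix.traceLinearMap (Fin m) ℝ ℝ) hB

theorem differentiableAt_matrix_inv (hB : DifferentiableAt ℝ B u) (hu : IsUnit (B u)) :
    DifferentiableAt ℝ (fun v => (B v)⁻¹) u := by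
  have := FiniteDimensional.complete ℝ (Matrix (Fin m) (Fin m) ℝ)
  simp only [Matrix.nonsing_inv_eq_ringInverse]
  exact (differentiableAt_inverse hu).comp u hB

theorem pd_matrix_apply (j : Fin n) (hB : DifferentiableAt ℝ B u) (a b : Fin m) :
    pd j (fun v => B v a b) u = pd j B u a b :=
  pd_linearMap_apply j (Matrix.entryLinearMap ℝ ℝ a b) hB

theorem pd_trace (j : Fin n) (hB : DifferentiableAt ℝ B u) :
    pd j (fun v => (B v).trace) u = (pd j B u).trace :=
  pd_linearMap_apply j (Matrix.traceLinearMap (Fin m) ℝ ℝ) hB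

theorem pd_trace_pow_succ (j : Fin n) (hB : DifferentiableAt ℝ B u) (k : ℕ) :
    pd j (fun v => (B v ^ (k + 1)).trace) u = ((k : ℝ) + 1) * (B u ^ k * pd j B u).trace := by
  have hpow : pd j (fun v => B v ^ (k + 1)) u =
      ∑ i ∈ range (k + 1), B u ^ (k - i) * pd j B u * B u ^ i := by
    rw [pd, fderiv_fun_pow' (k + 1) hB, _root_.sum_apply]
    rfl
  have hcyclic : ∀ i ∈ range (k + 1),
      (B u ^ (k - i) * pd j B u * B u ^ i).trace = (B u ^ k * pd j B u).trace := by
    intro i hi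
    rw [Matrix.trace_mul_cycle, ← pow_add, Nat.add_sub_cancel' (mem_range_succ_iff.mp hi)]
  rw [pd_trace j (hB.fun_pow _), hpow, Matrix.trace_sum, sum_congr rfl hcyclic, sum_const,
    card_range, nsmul_eq_mul, Nat.cast_succ]

end MatrixDerivatives

/-! ### Derivatives of the weighted symmetric functions -/

section SeriesDerivatives

open Filter Topology

variable {n : ℕ} {u : EuclideanSpace ℝ (Fin n)}

/-- The coefficientwise partial derivative of a family of power series. -/
def pdSeries (j : Fin n) (S : EuclideanSpace ℝ (Fin n) → ℝ⟦X⟧) (u : EuclideanSpace ℝ (Fin n)) :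
    ℝ⟦X⟧ :=
  PowerSeries.mk fun k => pd j (fun v => PowerSeries.coeff k (S v)) u

variable {S P : EuclideanSpace ℝ (Fin n) → ℝ⟦X⟧}

theorem pdSeries_congr (j : Fin n) (hSP : S =ᶠ[𝓝 u] P) : pdSeries j S u = pdSeries j P u := by
  ext k
  simp only [pdSeries, coeff_mk]
  exact pd_congr j (hSP.fun_comp (PowerSeries.coeff k))

theorem pdSeries_mul (j : Fin n)
    (hS : ∀ k, DifferentiableAt ℝ (fun v => PowerSeries.coeff k (S v)) u)
    (hP : ∀ k, DifferentiableAt ℝ (fun v => PowerSeries.coeff k (P v)) u) :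
    pdSeries j (fun v => S v * P v) u = pdSeries j S u * P u + S u * pdSeries j P u := by
  ext k
  simp only [pdSeries, map_add, PowerSeries.coeff_mul, coeff_mk]
  rw [pd_sum j _ fun a _ => (hS a.1).fun_mul (hP a.2), ← sum_add_distrib]
  exact sum_congr rfl fun a _ => pd_mul j (hS a.1) (hP a.2)

theorem derivative_pdSeries (j : Fin n)
    (hS : ∀ k, DifferentiableAt ℝ (fun v => PowerSeries.coeff k (S v)) u) :
    d⁄dX ℝ (pdSeries j S u) = pdSeries j (fun v => d⁄dX ℝ (S v)) u := by
  ext k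
  simp only [pdSeries, coeff_derivative, coeff_mk]
  rw [pd_mul j (hS _) (differentiableAt_const _), pd_const, mul_zero, add_zero]

theorem eq_zero_of_derivative_eq_mul {R : Type*} [CommRing R] [IsAddTorsionFree R] {f P : R⟦X⟧}
    (h0 : PowerSeries.coeff 0 f = 0) (hf : d⁄dX R f = f * P) : f = 0 := by
  ext k
  rw [map_zero]
  induction k using Nat.strong_induction_on with
  | _ k ih =>
    cases k with
    | zero => exact h0
    | succ k =>
      have hcoeff := congrArg (PowerSeries.coeff k) hf
      rw [coeff_derivative, PowerSeries.coeff_mul, sum_eq_zero fun a ha => by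
        rw [ih a.1 (Nat.antidiagonal.fst_lt ha), zero_mul]] at hcoeff
      rw [← Nat.cast_succ, mul_comm, ← nsmul_eq_mul] at hcoeff
      exact (smul_eq_zero_iff_right k.succ_ne_zero).mp hcoeff

theorem differentiableAt_coeff_of_derivative_eq_mul
    (h0 : DifferentiableAt ℝ (fun v => PowerSeries.coeff 0 (S v)) u)
    (hS : ∀ᶠ v in 𝓝 u, d⁄dX ℝ (S v) = S v * P v)
    (hP : ∀ k, DifferentiableAt ℝ (fun v => PowerSeries.coeff k (P v)) u) (k : ℕ) :
    DifferentiableAt ℝ (fun v => PowerSeries.coeff k (S v)) u := by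
  induction k using Nat.strong_induction_on with
  | _ k ih =>
    cases k with
    | zero => exact h0
    | succ k =>
      have hrec : (fun v => PowerSeries.coeff (k + 1) (S v)) =ᶠ[𝓝 u] fun v =>
          ((k : ℝ) + 1)⁻¹ *
            ∑ a ∈ antidiagonal k, PowerSeries.coeff a.1 (S v) * PowerSeries.coeff a.2 (P v) := by
        filter_upwards [hS] with v hv
        rw [← PowerSeries.coeff_mul, ← hv, coeff_derivative, mul_comm _ ((k : ℝ) + 1),
          inv_mul_cancel_left₀ k.cast_add_one_ne_zero]
      have hsum : DifferentiableAt ℝ (fun v => ∑ a ∈ antidiagonal k,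
          PowerSeries.coeff a.1 (S v) * PowerSeries.coeff a.2 (P v)) u :=
        DifferentiableAt.fun_sum fun a ha =>
          (ih a.1 (Nat.antidiagonal.fst_lt ha)).mul (hP a.2)
      exact (hsum.const_mul _).congr_of_eventuallyEq hrec

/-- Formally `S = exp ∫ P` and `X * Q = ∂ⱼ ∫ P`, so the claim is the chain rule. -/
theorem pdSeries_eq_mul_of_derivative_eq_mul (j : Fin n) {c : ℝ} {Q : ℝ⟦X⟧}
    (h0 : ∀ v, PowerSeries.coeff 0 (S v) = c)
    (hS : ∀ᶠ v in 𝓝 u, d⁄dX ℝ (S v) = S v * P v)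
    (hP : ∀ k, DifferentiableAt ℝ (fun v => PowerSeries.coeff k (P v)) u)
    (hQ : pdSeries j P u = d⁄dX ℝ (X * Q)) :
    pdSeries j S u = S u * (X * Q) := by
  have hSdiff := differentiableAt_coeff_of_derivative_eq_mul
    (by simp only [h0, differentiableAt_const]) hS hP
  refine sub_eq_zero.mp (eq_zero_of_derivative_eq_mul (P := P u) ?_ ?_)
  · rw [← mul_assoc, mul_comm _ X, mul_assoc, map_sub, PowerSeries.coeff_zero_X_mul, sub_zero,
      pdSeries, coeff_mk]
    simp only [h0, pd_const]
  · rw [map_sub, derivative_pdSeries j hSdiff, pdSeries_congr j hS, pdSeries_mul j hSdiff hP,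
      Derivation.leibniz, hQ, hS.self_of_nhds, smul_eq_mul, smul_eq_mul]
    ring

open scoped Matrix.Norms.Operator

variable {A : EuclideanSpace ℝ (Fin n) → Matrix (Fin n) (Fin n) ℝ}

theorem differentiableAt_coeff_traceSeries_add_C (hA : DifferentiableAt ℝ A u) (c : ℝ) (k : ℕ) :
    DifferentiableAt ℝ
      (fun v => PowerSeries.coeff k (traceSeries (A v) (A v) + PowerSeries.C c)) u := by
  simp only [map_add, traceSeries, coeff_mk]
  exact ((differentiableAt_trace ((hA.pow k).mul hA)).const_mul _).add_const _

theorem pdSeries_traceSeries_add_C (j : Fin n) (hA : DifferentiableAt ℝ A u) (c : ℝ) :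
    pdSeries j (fun v => traceSeries (A v) (A v) + PowerSeries.C c) u =
      d⁄dX ℝ (X * traceSeries (A u) (pd j A u)) := by
  ext k
  simp only [pdSeries, coeff_derivative, PowerSeries.coeff_succ_X_mul, traceSeries, coeff_mk,
    map_add, ← pow_succ]
  rw [pd, fderiv_add_const]
  change pd j (fun v => (-1) ^ k * (A v ^ (k + 1)).trace) u = _
  rw [pd_mul j (differentiableAt_const _) (differentiableAt_trace (hA.fun_pow _)), pd_const,
    pd_trace_pow_succ j hA]
  ring

theorem differentiableAt_wsigma (hA : DifferentiableAt ℝ A u)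
    (hdiag : ∀ᶠ v in 𝓝 u, IsDiagonalizable (A v)) (μ₀ : ℝ) (r : ℕ) :
    DifferentiableAt ℝ (fun v => wsigma μ₀ (A v) r) u := by
  have hseries := differentiableAt_coeff_of_derivative_eq_mul
    (by simp only [wsigmaSeries, coeff_mk, wsigma_zero, differentiableAt_const])
    (hdiag.mono fun v hv => hv.derivative_wsigmaSeries μ₀)
    (differentiableAt_coeff_traceSeries_add_C hA μ₀) r
  simpa only [wsigmaSeries, coeff_mk] using hseries

theorem pd_wsigma_succ (j : Fin n) (hA : DifferentiableAt ℝ A u)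
    (hdiag : ∀ᶠ v in 𝓝 u, IsDiagonalizable (A v)) (μ₀ : ℝ) (r : ℕ) :
    pd j (fun v => wsigma μ₀ (A v) (r + 1)) u = (wNewton μ₀ (A u) r * pd j A u).trace := by
  have hseries := pdSeries_eq_mul_of_derivative_eq_mul j
    (fun v => by rw [wsigmaSeries, coeff_mk, wsigma_zero])
    (hdiag.mono fun v hv => hv.derivative_wsigmaSeries μ₀)
    (differentiableAt_coeff_traceSeries_add_C hA μ₀) (pdSeries_traceSeries_add_C j hA μ₀)
  have hcoeff := congrArg (PowerSeries.coeff (r + 1)) hseries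
  rw [mul_left_comm, PowerSeries.coeff_succ_X_mul, coeff_wsigmaSeries_mul_traceSeries] at hcoeff
  simpa only [pdSeries, wsigmaSeries, coeff_mk] using hcoeff

theorem differentiableAt_wNewton (hA : DifferentiableAt ℝ A u)
    (hdiag : ∀ᶠ v in 𝓝 u, IsDiagonalizable (A v)) (μ₀ : ℝ) (r : ℕ) :
    DifferentiableAt ℝ (fun v => wNewton μ₀ (A v) r) u :=
  DifferentiableAt.fun_sum fun j _ =>
    ((differentiableAt_wsigma hA hdiag μ₀ _).const_mul _).smul (hA.pow j)

end SeriesDerivatives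

/-! ### Covariant derivatives -/

section CovariantDerivative

open Filter Topology

variable {n : ℕ} {𝔸 : Type*} [NormedRing 𝔸] [NormedAlgebra ℝ 𝔸] {u : EuclideanSpace ℝ (Fin n)}

/-- The covariant derivative along `x_j` of a field of linear maps between two bundles, where `L`
and `R` are the connection matrices of the target and of the source in the direction `x_j`. If
the tangent bundle has connection matrix `Γ`, then the cotangent bundle has `-Γᵀ`. -/
def covPd (j : Fin n) (L R : 𝔸) (B : EuclideanSpace ℝ (Fin n) → 𝔸)
    (u : EuclideanSpace ℝ (Fin n)) : 𝔸 :=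
  pd j B u + L * B u - B u * R

variable {B C : EuclideanSpace ℝ (Fin n) → 𝔸}

theorem covPd_congr (j : Fin n) (L R : 𝔸) (hBC : B =ᶠ[𝓝 u] C) :
    covPd j L R B u = covPd j L R C u := by
  rw [covPd, covPd, pd_congr j hBC, hBC.self_of_nhds]

theorem covPd_one (j : Fin n) (L : 𝔸) : covPd j L L (fun _ => 1) u = 0 := by
  simp [covPd, pd_const]

theorem covPd_sub (j : Fin n) (L R : 𝔸) (hB : DifferentiableAt ℝ B u)
    (hC : DifferentiableAt ℝ C u) :
    covPd j L R (fun v => B v - C v) u = covPd j L R B u - covPd j L R C u := by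
  rw [covPd, covPd, covPd, pd_sub j hB hC]
  noncomm_ring

theorem covPd_smul (j : Fin n) (L R : 𝔸) {f : EuclideanSpace ℝ (Fin n) → ℝ}
    (hf : DifferentiableAt ℝ f u) (hB : DifferentiableAt ℝ B u) :
    covPd j L R (fun v => f v • B v) u = f u • covPd j L R B u + pd j f u • B u := by
  rw [covPd, covPd, pd_smul j hf hB, smul_sub, smul_add, mul_smul_comm, smul_mul_assoc]
  abel

theorem covPd_mul (j : Fin n) (L M R : 𝔸) (hB : DifferentiableAt ℝ B u)
    (hC : DifferentiableAt ℝ C u) :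
    covPd j L R (fun v => B v * C v) u = covPd j L M B u * C u + B u * covPd j M R C u := by
  rw [covPd, covPd, covPd, pd_mul j hB hC]
  noncomm_ring

theorem covPd_eq_zero_of_mul_eq_one (j : Fin n) {L R : 𝔸} (hB : DifferentiableAt ℝ B u)
    (hC : DifferentiableAt ℝ C u) (hBC : ∀ᶠ v in 𝓝 u, B v * C v = 1) (hCB : C u * B u = 1)
    (hpar : covPd j L R B u = 0) : covPd j R L C u = 0 := by
  have hprod : covPd j L R B u * C u + B u * covPd j R L C u = 0 := by
    rw [← covPd_mul j L R L hB hC, covPd_congr j L L hBC, covPd_one]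
  rw [hpar, zero_mul, zero_add] at hprod
  rw [← one_mul (covPd j R L C u), ← hCB, mul_assoc, hprod, mul_zero]

open scoped Matrix.Norms.Operator

theorem trace_mul_covPd_of_commute {m : ℕ} (j : Fin n) (Γ : Matrix (Fin m) (Fin m) ℝ)
    {A : EuclideanSpace ℝ (Fin n) → Matrix (Fin m) (Fin m) ℝ} {T : Matrix (Fin m) (Fin m) ℝ}
    (hT : Commute T (A u)) : (T * covPd j Γ Γ A u).trace = (T * pd j A u).trace := by
  have hcyclic : (T * (Γ * A u)).trace = (T * (A u * Γ)).trace := by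
    rw [← mul_assoc, Matrix.trace_mul_cycle, ← hT.eq, mul_assoc]
  rw [covPd, mul_sub, mul_add, Matrix.trace_sub, Matrix.trace_add, hcyclic, add_sub_cancel_right]

end CovariantDerivative

/-! ### The Levi-Civita connection -/

section LeviCivita

open Filter Topology

variable {n : ℕ} {u : EuclideanSpace ℝ (Fin n)}
  {g T : EuclideanSpace ℝ (Fin n) → Matrix (Fin n) (Fin n) ℝ}

/-- The connection matrices `(Γ_j)^i_k = Γ^i_{jk}` of the Levi-Civita connection at `u`. -/
def christoffelMat (g : EuclideanSpace ℝ (Fin n) → Matrix (Fin n) (Fin n) ℝ)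
    (u : EuclideanSpace ℝ (Fin n)) (j : Fin n) : Matrix (Fin n) (Fin n) ℝ :=
  Matrix.of fun i k => christoffel g i j k u

theorem christoffel_comm (hsymm : ∀ᶠ v in 𝓝 u, (g v).IsSymm) (k i j : Fin n) :
    christoffel g k i j u = christoffel g k j i u := by
  have hpd : ∀ l, pd l (fun v => g v i j) u = pd l (fun v => g v j i) u := fun l =>
    pd_congr l (hsymm.mono fun v hv => hv.apply j i)
  simp only [christoffel, hpd, add_comm (pd i _ u)]

theorem metric_mul_christoffelMat (hdet : IsUnit (g u).det) (j : Fin n) :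
    g u * christoffelMat g u j = Matrix.of fun l k => (1 / 2) *
      (pd j (fun v => g v k l) u + pd k (fun v => g v j l) u - pd l (fun v => g v j k) u) := by
  rw [← Matrix.mul_nonsing_inv_cancel_left (A := g u) (Matrix.of fun l k => (1 / 2) *
    (pd j (fun v => g v k l) u + pd k (fun v => g v j l) u - pd l (fun v => g v j k) u)) hdet]
  congr 1
  ext i k
  simp only [christoffelMat, christoffel, Matrix.of_apply, Matrix.mul_apply, mul_sum,
    mul_left_comm]

open scoped Matrix.Norms.Operator

theorem covPd_metric_eq_zero (hg : DifferentiableAt ℝ g u) (hsymm : ∀ᶠ v in 𝓝 u, (g v).IsSymm)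
    (hdet : IsUnit (g u).det) (j : Fin n) :
    covPd j (-(christoffelMat g u j)ᵀ) (christoffelMat g u j) g u = 0 := by
  have htranspose : (christoffelMat g u j)ᵀ * g u = (g u * christoffelMat g u j)ᵀ := by
    rw [Matrix.transpose_mul, hsymm.self_of_nhds]
  have hpd : ∀ k l, pd j (fun v => g v k l) u = pd j (fun v => g v l k) u := fun k l =>
    pd_congr j (hsymm.mono fun v hv => hv.apply l k)
  ext l k
  rw [covPd, neg_mul, htranspose, metric_mul_christoffelMat hdet]
  simp only [Matrix.sub_apply, Matrix.add_apply, Matrix.neg_apply, Matrix.transpose_apply,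
    Matrix.of_apply, Matrix.zero_apply, ← pd_matrix_apply j hg]
  rw [hpd k l]
  ring

theorem covDivTensor_eq_sum_covPd (hT : DifferentiableAt ℝ T u) (i : Fin n) :
    covDivTensor g T i u =
      ∑ j, covPd j (christoffelMat g u j) (-(christoffelMat g u j)ᵀ) T u i j := by
  simp only [covDivTensor, covPd, mul_neg, sub_neg_eq_add, Matrix.add_apply, sum_add_distrib,
    Matrix.mul_apply, Matrix.transpose_apply, christoffelMat, Matrix.of_apply,
    pd_matrix_apply _ hT, mul_comm (T u i _)]

theorem covDiv_sum_mul_pd {f : EuclideanSpace ℝ (Fin n) → ℝ} (hT : DifferentiableAt ℝ T u)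
    (hf : ∀ i, DifferentiableAt ℝ (pd i f) u) :
    covDiv g (fun v j => ∑ i, T v i j * pd i f v) u =
      ∑ i, covDivTensor g T i u * pd i f u + ∑ i, ∑ j, T u i j * covHess g f j i u := by
  have hleibniz : ∀ j, pd j (fun v => ∑ i, T v i j * pd i f v) u =
      ∑ i, (pd j (fun v => T v i j) u * pd i f u + T u i j * pd j (pd i f) u) := by
    intro j
    rw [pd_sum j _ fun i _ => (differentiableAt_matrix_apply hT i j).fun_mul (hf i)]
    exact sum_congr rfl fun i _ => pd_mul j (differentiableAt_matrix_apply hT i j) (hf i)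
  have hderiv : ∑ j, ∑ i, pd j (fun v => T v i j) u * pd i f u =
      ∑ i, ∑ j, pd j (fun v => T v i j) u * pd i f u := sum_comm
  have hhess : ∑ j, ∑ i, T u i j * pd j (pd i f) u =
      ∑ i, ∑ j, T u i j * pd j (pd i f) u := sum_comm
  have htrace : ∑ j, ∑ k, ∑ i, christoffel g j j k u * (T u i k * pd i f u) =
      ∑ i, ∑ j, ∑ k, christoffel g j j k u * T u i k * pd i f u := by
    conv_rhs => rw [sum_comm]
    refine sum_congr rfl fun j _ => ?_
    rw [sum_comm]
    simp only [mul_assoc]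
  have hcancel : ∑ i, ∑ j, ∑ k, christoffel g i j k u * T u k j * pd i f u =
      ∑ i, ∑ j, ∑ k, T u i j * (christoffel g k j i u * pd k f u) := by
    conv_lhs => rw [sum_comm]
    conv_rhs => rw [sum_comm]
    refine sum_congr rfl fun j _ => ?_
    rw [sum_comm]
    exact sum_congr rfl fun i _ => sum_congr rfl fun k _ => by ring
  simp only [covDiv, covDivTensor, covHess, hleibniz, add_mul, mul_sub, sum_add_distrib,
    sum_sub_distrib, mul_sum, sum_mul, hderiv, hhess, htrace, hcancel]
  ring

end LeviCivita

/-! ### Divergence of the weighted Newton tensor of a Codazzi tensor -/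

section Codazzi

open Filter Topology
open scoped Matrix.Norms.Operator

variable {n : ℕ} {u : EuclideanSpace ℝ (Fin n)}

/-- The weighted Newton tensor `T_r^∞(g⁻¹ S)` with its second index raised by `g`. -/
def raisedNewton (μ₀ : ℝ) (r : ℕ) (g S : Matrix (Fin n) (Fin n) ℝ) : Matrix (Fin n) (Fin n) ℝ :=
  wNewton μ₀ (g⁻¹ * S) r * g⁻¹

theorem raisedNewton_zero (μ₀ : ℝ) (g S : Matrix (Fin n) (Fin n) ℝ) :
    raisedNewton μ₀ 0 g S = g⁻¹ := by
  rw [raisedNewton, wNewton_zero, one_mul]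

theorem raisedNewton_succ (μ₀ : ℝ) (r : ℕ) (g S : Matrix (Fin n) (Fin n) ℝ) :
    raisedNewton μ₀ (r + 1) g S =
      wsigma μ₀ (g⁻¹ * S) (r + 1) • g⁻¹ - g⁻¹ * S * raisedNewton μ₀ r g S := by
  rw [raisedNewton, wNewton_succ, sub_mul, smul_one_mul, mul_assoc, raisedNewton]

/-- A positive definite `g` and a symmetric `S` satisfying Codazzi's equation
`∇_j S_{lk} = ∇_l S_{jk}` at `u`, for a connection with connection matrices `Γ j` at `u` that makes
`g` parallel there.
This is all that the divergence theorem for Newton tensors uses about a hypersurface. -/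
structure IsCodazziPairAt (Γ : Fin n → Matrix (Fin n) (Fin n) ℝ)
    (g S : EuclideanSpace ℝ (Fin n) → Matrix (Fin n) (Fin n) ℝ)
    (u : EuclideanSpace ℝ (Fin n)) : Prop where
  differentiableAt_metric : DifferentiableAt ℝ g u
  differentiableAt_tensor : DifferentiableAt ℝ S u
  posDef : ∀ᶠ v in 𝓝 u, (g v).PosDef
  isHermitian : ∀ᶠ v in 𝓝 u, (S v).IsHermitian
  parallel : ∀ j, covPd j (-(Γ j)ᵀ) (Γ j) g u = 0
  codazzi : ∀ j l k, covPd j (-(Γ j)ᵀ) (Γ j) S u l k = covPd l (-(Γ l)ᵀ) (Γ l) S u j k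

theorem sum_mul_mul_apply_of_apply_comm {D : Fin n → Matrix (Fin n) (Fin n) ℝ}
    (hD : ∀ j l k, D j l k = D l j k) (P U : Matrix (Fin n) (Fin n) ℝ) (i : Fin n) :
    ∑ j, (P * D j * U) i j = ∑ j, P i j * (U * D j).trace := by
  calc ∑ j, (P * D j * U) i j = ∑ j, ∑ l, P i l * (D j * U) l j := by
        simp only [mul_assoc, Matrix.mul_apply (M := P)]
    _ = ∑ l, P i l * ∑ j, (D j * U) l j := by
        rw [sum_comm]
        simp only [mul_sum]
    _ = ∑ l, P i l * (U * D l).trace := sum_congr rfl fun l _ => by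
        rw [Matrix.trace_mul_comm]
        simp only [Matrix.trace, Matrix.diag_apply, Matrix.mul_apply, hD _ l]

namespace IsCodazziPairAt

variable {Γ : Fin n → Matrix (Fin n) (Fin n) ℝ}
  {g S : EuclideanSpace ℝ (Fin n) → Matrix (Fin n) (Fin n) ℝ}

theorem eventually_isDiagonalizable (h : IsCodazziPairAt Γ g S u) :
    ∀ᶠ v in 𝓝 u, IsDiagonalizable ((g v)⁻¹ * S v) := by
  filter_upwards [h.posDef, h.isHermitian] with v hg hS using isDiagonalizable_inv_mul hg hS

theorem eventually_isUnit_det (h : IsCodazziPairAt Γ g S u) : ∀ᶠ v in 𝓝 u, IsUnit (g v).det :=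
  h.posDef.mono fun _ hg => hg.det_pos.ne'.isUnit

theorem differentiableAt_inv (h : IsCodazziPairAt Γ g S u) :
    DifferentiableAt ℝ (fun v => (g v)⁻¹) u :=
  differentiableAt_matrix_inv h.differentiableAt_metric h.posDef.self_of_nhds.isUnit

theorem differentiableAt_inv_mul (h : IsCodazziPairAt Γ g S u) :
    DifferentiableAt ℝ (fun v => (g v)⁻¹ * S v) u :=
  h.differentiableAt_inv.mul h.differentiableAt_tensor

theorem differentiableAt_raisedNewton (h : IsCodazziPairAt Γ g S u) (μ₀ : ℝ) (r : ℕ) :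
    DifferentiableAt ℝ (fun v => raisedNewton μ₀ r (g v) (S v)) u :=
  (differentiableAt_wNewton h.differentiableAt_inv_mul h.eventually_isDiagonalizable μ₀ r).mul
    h.differentiableAt_inv

theorem covPd_inv (h : IsCodazziPairAt Γ g S u) (j : Fin n) :
    covPd j (Γ j) (-(Γ j)ᵀ) (fun v => (g v)⁻¹) u = 0 :=
  covPd_eq_zero_of_mul_eq_one j h.differentiableAt_metric h.differentiableAt_inv
    (h.eventually_isUnit_det.mono fun _ hg => Matrix.mul_nonsing_inv _ hg)
    (Matrix.nonsing_inv_mul _ h.eventually_isUnit_det.self_of_nhds) (h.parallel j)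

theorem covPd_inv_mul (h : IsCodazziPairAt Γ g S u) (j : Fin n) :
    covPd j (Γ j) (Γ j) (fun v => (g v)⁻¹ * S v) u =
      (g u)⁻¹ * covPd j (-(Γ j)ᵀ) (Γ j) S u := by
  rw [covPd_mul j (Γ j) (-(Γ j)ᵀ) (Γ j) h.differentiableAt_inv h.differentiableAt_tensor,
    h.covPd_inv, zero_mul, zero_add]

theorem pd_wsigma_succ_eq_trace (h : IsCodazziPairAt Γ g S u) (μ₀ : ℝ) (r : ℕ) (j : Fin n) :
    pd j (fun v => wsigma μ₀ ((g v)⁻¹ * S v) (r + 1)) u =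
      (raisedNewton μ₀ r (g u) (S u) * covPd j (-(Γ j)ᵀ) (Γ j) S u).trace := by
  rw [pd_wsigma_succ j h.differentiableAt_inv_mul h.eventually_isDiagonalizable,
    ← trace_mul_covPd_of_commute j (Γ j) (A := fun v => (g v)⁻¹ * S v)
      (wNewton_commute μ₀ _ r), h.covPd_inv_mul, raisedNewton, mul_assoc]

theorem covPd_raisedNewton_succ (h : IsCodazziPairAt Γ g S u) (μ₀ : ℝ) (r : ℕ) (j : Fin n) :
    covPd j (Γ j) (-(Γ j)ᵀ) (fun v => raisedNewton μ₀ (r + 1) (g v) (S v)) u =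
      (raisedNewton μ₀ r (g u) (S u) * covPd j (-(Γ j)ᵀ) (Γ j) S u).trace • (g u)⁻¹
        - (g u)⁻¹ * covPd j (-(Γ j)ᵀ) (Γ j) S u * raisedNewton μ₀ r (g u) (S u)
        - (g u)⁻¹ * S u *
          covPd j (Γ j) (-(Γ j)ᵀ) (fun v => raisedNewton μ₀ r (g v) (S v)) u := by
  have hw := differentiableAt_wsigma h.differentiableAt_inv_mul h.eventually_isDiagonalizable μ₀
    (r + 1)
  have hU := h.differentiableAt_raisedNewton μ₀ r
  simp only [raisedNewton_succ]
  rw [covPd_sub j _ _ (hw.fun_smul h.differentiableAt_inv) (h.differentiableAt_inv_mul.fun_mul hU),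
    covPd_smul j _ _ hw h.differentiableAt_inv, h.covPd_inv, smul_zero, zero_add,
    h.pd_wsigma_succ_eq_trace, covPd_mul j _ (Γ j) _ h.differentiableAt_inv_mul hU,
    h.covPd_inv_mul, sub_add_eq_sub_sub]

theorem sum_covPd_raisedNewton (h : IsCodazziPairAt Γ g S u) (μ₀ : ℝ) (r : ℕ) (i : Fin n) :
    ∑ j, covPd j (Γ j) (-(Γ j)ᵀ) (fun v => raisedNewton μ₀ r (g v) (S v)) u i j = 0 := by
  induction r generalizing i with
  | zero => simp only [raisedNewton_zero, h.covPd_inv, Matrix.zero_apply, sum_const_zero]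
  | succ r ih =>
    have hlast : ∑ j, ((g u)⁻¹ * S u *
        covPd j (Γ j) (-(Γ j)ᵀ) (fun v => raisedNewton μ₀ r (g v) (S v)) u) i j = 0 := by
      simp only [Matrix.mul_apply (M := (g u)⁻¹ * S u)]
      rw [sum_comm]
      simp only [← mul_sum, ih, mul_zero, sum_const_zero]
    simp only [h.covPd_raisedNewton_succ, Matrix.sub_apply, sum_sub_distrib, hlast,
      sum_mul_mul_apply_of_apply_comm h.codazzi, Matrix.smul_apply, smul_eq_mul, mul_comm,
      sub_self]

theorem covDivTensor_raisedNewton (h : IsCodazziPairAt (christoffelMat g u) g S u) (μ₀ : ℝ)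
    (r : ℕ) (i : Fin n) : covDivTensor g (fun v => raisedNewton μ₀ r (g v) (S v)) i u = 0 := by
  rw [covDivTensor_eq_sum_covPd (h.differentiableAt_raisedNewton μ₀ r), h.sum_covPd_raisedNewton]

end IsCodazziPairAt

end Codazzi

/-! ### Hypersurfaces in coordinates -/

section LocalHypersurface

open Filter Topology
open scoped Matrix.Norms.Operator

theorem eq_zero_of_inner_eq_zero_of_card_add_one {𝕜 E ι : Type*} [RCLike 𝕜]
    [NormedAddCommGroup E] [InnerProductSpace 𝕜 E] [FiniteDimensional 𝕜 E] [Fintype ι] {b : ι → E}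
    (hb : LinearIndependent 𝕜 b) (hcard : Fintype.card ι + 1 = Module.finrank 𝕜 E) {x w : E}
    (hx : x ≠ 0) (hbx : ∀ i, inner 𝕜 (b i) x = 0) (hbw : ∀ i, inner 𝕜 (b i) w = 0)
    (hxw : inner 𝕜 x w = 0) : w = 0 := by
  set W := Submodule.span 𝕜 (Set.range b)
  have hperp : Module.finrank 𝕜 Wᗮ = 1 := by
    have hsum := W.finrank_add_finrank_orthogonal
    rw [finrank_span_eq_card hb] at hsum
    omega
  have mem_perp : ∀ y, (∀ i, inner 𝕜 (b i) y = 0) → y ∈ Wᗮ := fun y hy => by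
    have hle : W ≤ (Submodule.span 𝕜 {y})ᗮ := Submodule.span_le.mpr (Set.range_subset_iff.mpr
      fun i => Submodule.mem_orthogonal_singleton_iff_inner_left.mpr (hy i))
    exact (Submodule.mem_orthogonal W y).mpr fun x hx =>
      Submodule.mem_orthogonal_singleton_iff_inner_left.mp (hle hx)
  obtain ⟨c, hc⟩ := (finrank_eq_one_iff_of_nonzero' (⟨x, mem_perp x hbx⟩ : Wᗮ)
    (by simpa using hx)).mp hperp ⟨w, mem_perp w hbw⟩
  obtain rfl : c • x = w := congrArg Subtype.val hc
  rw [inner_smul_right, mul_eq_zero, inner_self_eq_zero, or_iff_left hx] at hxw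
  rw [hxw, zero_smul]

variable {n : ℕ} {φ N : EuclideanSpace ℝ (Fin n) → EuclideanSpace ℝ (Fin (n + 1))}
  {U : Set (EuclideanSpace ℝ (Fin n))} {u : EuclideanSpace ℝ (Fin n)}

theorem metric_isSymm (φ : EuclideanSpace ℝ (Fin n) → EuclideanSpace ℝ (Fin (n + 1)))
    (u : EuclideanSpace ℝ (Fin n)) : (metric φ u).IsSymm :=
  Matrix.IsSymm.ext fun i j => real_inner_comm (pd i φ u) (pd j φ u)

/-- `φ` parametrizes a hypersurface over the open set `U`, with unit normal `N`: the form that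
`IsHypersurface` takes in a chart. -/
structure IsLocalHypersurface (φ N : EuclideanSpace ℝ (Fin n) → EuclideanSpace ℝ (Fin (n + 1)))
    (U : Set (EuclideanSpace ℝ (Fin n))) : Prop where
  isOpen : IsOpen U
  smooth : ContDiffOn ℝ ∞ φ U
  immersion : ∀ u ∈ U, Function.Injective (fderiv ℝ φ u)
  normal_smooth : ContDiffOn ℝ ∞ N U
  normal_unit : ∀ u ∈ U, ‖N u‖ = 1
  normal_orthogonal : ∀ u ∈ U, ∀ w, inner ℝ (fderiv ℝ φ u w) (N u) = 0

namespace IsLocalHypersurface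

theorem eventually_mem (h : IsLocalHypersurface φ N U) (hu : u ∈ U) : ∀ᶠ v in 𝓝 u, v ∈ U :=
  h.isOpen.mem_nhds hu

theorem contDiffAt (h : IsLocalHypersurface φ N U) (hu : u ∈ U) : ContDiffAt ℝ ∞ φ u :=
  h.smooth.contDiffAt (h.eventually_mem hu)

theorem contDiffAt_pd (h : IsLocalHypersurface φ N U) (hu : u ∈ U) (i : Fin n) :
    ContDiffAt ℝ ∞ (pd i φ) u :=
  WeightedCurvature.contDiffAt_pd (h.contDiffAt hu) i (by simp)

theorem differentiableAt (h : IsLocalHypersurface φ N U) (hu : u ∈ U) : DifferentiableAt ℝ φ u :=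
  (h.contDiffAt hu).differentiableAt (by simp)

theorem differentiableAt_pd (h : IsLocalHypersurface φ N U) (hu : u ∈ U) (i : Fin n) :
    DifferentiableAt ℝ (pd i φ) u :=
  (h.contDiffAt_pd hu i).differentiableAt (by simp)

theorem differentiableAt_pd_pd (h : IsLocalHypersurface φ N U) (hu : u ∈ U) (i j : Fin n) :
    DifferentiableAt ℝ (pd i (pd j φ)) u :=
  (WeightedCurvature.contDiffAt_pd (m := ∞) (h.contDiffAt_pd hu j) i (by simp)).differentiableAt
    (by simp)

theorem differentiableAt_normal (h : IsLocalHypersurface φ N U) (hu : u ∈ U) :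
    DifferentiableAt ℝ N u :=
  (h.normal_smooth.contDiffAt (h.eventually_mem hu)).differentiableAt (by simp)

theorem pd_pd_comm (h : IsLocalHypersurface φ N U) (hu : u ∈ U) (i j : Fin n) :
    pd i (pd j φ) u = pd j (pd i φ) u :=
  pd_comm ((h.contDiffAt hu).of_le ENat.LEInfty.out) i j

theorem pd_pd_pd_comm (h : IsLocalHypersurface φ N U) (hu : u ∈ U) (i j k : Fin n) :
    pd i (pd j (pd k φ)) u = pd j (pd i (pd k φ)) u :=
  pd_comm ((h.contDiffAt_pd hu k).of_le ENat.LEInfty.out) i j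

theorem normal_ne_zero (h : IsLocalHypersurface φ N U) (hu : u ∈ U) : N u ≠ 0 :=
  norm_ne_zero_iff.mp (by rw [h.normal_unit u hu]; exact one_ne_zero)

theorem exists_normal_apply_ne_zero (h : IsLocalHypersurface φ N U) (hu : u ∈ U) :
    ∃ a, N u a ≠ 0 := by
  by_contra! hN
  exact h.normal_ne_zero hu (PiLp.ext hN)

theorem inner_normal_self (h : IsLocalHypersurface φ N U) (hu : u ∈ U) :
    inner ℝ (N u) (N u) = 1 := by
  rw [real_inner_self_eq_norm_sq, h.normal_unit u hu, one_pow]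

theorem inner_pd_normal (h : IsLocalHypersurface φ N U) (hu : u ∈ U) (i : Fin n) :
    inner ℝ (pd i φ u) (N u) = 0 :=
  h.normal_orthogonal u hu _

theorem inner_pd_pd_normal (h : IsLocalHypersurface φ N U) (hu : u ∈ U) (i j : Fin n) :
    inner ℝ (pd i φ u) (pd j N u) = -secondForm φ N u j i := by
  have hconst : pd j (fun v => inner ℝ (pd i φ v) (N v)) u = 0 := by
    rw [pd_congr j ((h.eventually_mem hu).mono fun v hv => h.inner_pd_normal hv i), pd_const]
  rw [pd_inner j (h.differentiableAt_pd hu i) (h.differentiableAt_normal hu)] at hconst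
  exact eq_neg_of_add_eq_zero_right hconst

theorem inner_normal_pd_normal (h : IsLocalHypersurface φ N U) (hu : u ∈ U) (j : Fin n) :
    inner ℝ (N u) (pd j N u) = 0 := by
  have hconst : pd j (fun v => inner ℝ (N v) (N v)) u = 0 := by
    rw [pd_congr j ((h.eventually_mem hu).mono fun v hv => h.inner_normal_self hv), pd_const]
  rw [pd_inner j (h.differentiableAt_normal hu) (h.differentiableAt_normal hu),
    real_inner_comm] at hconst
  linarith

theorem linearIndependent_pd (h : IsLocalHypersurface φ N U) (hu : u ∈ U) :
    LinearIndependent ℝ fun i => pd i φ u := by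
  have hbasis : LinearIndependent ℝ fun i : Fin n => EuclideanSpace.single i (1 : ℝ) := by
    simpa only [← EuclideanSpace.basisFun_apply] using
      (EuclideanSpace.basisFun (Fin n) ℝ).orthonormal.linearIndependent
  exact hbasis.map' (fderiv ℝ φ u).toLinearMap (LinearMap.ker_eq_bot.mpr (h.immersion u hu))

theorem metric_posDef (h : IsLocalHypersurface φ N U) (hu : u ∈ U) : (metric φ u).PosDef :=
  Matrix.posDef_gram_of_linearIndependent (h.linearIndependent_pd hu)

theorem isUnit_det_metric (h : IsLocalHypersurface φ N U) (hu : u ∈ U) :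
    IsUnit (metric φ u).det :=
  (h.metric_posDef hu).det_pos.ne'.isUnit

theorem differentiableAt_metric (h : IsLocalHypersurface φ N U) (hu : u ∈ U) :
    DifferentiableAt ℝ (metric φ) u :=
  differentiableAt_matrix_of_apply fun i j =>
    (h.differentiableAt_pd hu i).inner ℝ (h.differentiableAt_pd hu j)

theorem differentiableAt_secondForm (h : IsLocalHypersurface φ N U) (hu : u ∈ U) :
    DifferentiableAt ℝ (secondForm φ N) u :=
  differentiableAt_matrix_of_apply fun i j =>
    (h.differentiableAt_pd_pd hu i j).inner ℝ (h.differentiableAt_normal hu)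

theorem secondForm_isSymm (h : IsLocalHypersurface φ N U) (hu : u ∈ U) :
    (secondForm φ N u).IsSymm :=
  Matrix.IsSymm.ext fun i j => by
    simp only [secondForm, Matrix.of_apply, h.pd_pd_comm hu i j]

theorem inner_pd_pd_pd (h : IsLocalHypersurface φ N U) (hu : u ∈ U) (l i j : Fin n) :
    inner ℝ (pd l φ u) (pd i (pd j φ) u) =
      (metric φ u * christoffelMat (metric φ) u i) l j := by
  have hpd : ∀ a b c, pd a (fun v => metric φ v b c) u =
      inner ℝ (pd a (pd b φ) u) (pd c φ u) + inner ℝ (pd b φ u) (pd a (pd c φ) u) := fun a b c =>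
    pd_inner a (h.differentiableAt_pd hu b) (h.differentiableAt_pd hu c)
  rw [metric_mul_christoffelMat (h.isUnit_det_metric hu), Matrix.of_apply, hpd, hpd, hpd,
    h.pd_pd_comm hu j i, h.pd_pd_comm hu l i, h.pd_pd_comm hu l j,
    real_inner_comm (pd i (pd j φ) u) (pd l φ u), real_inner_comm (pd i (pd l φ) u) (pd j φ u)]
  ring

theorem gauss_formula (h : IsLocalHypersurface φ N U) (hu : u ∈ U) (i j : Fin n) :
    pd i (pd j φ) u = ∑ k, christoffel (metric φ) k i j u • pd k φ u
      + secondForm φ N u i j • N u := by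
  refine sub_eq_zero.mp (eq_zero_of_inner_eq_zero_of_card_add_one (h.linearIndependent_pd hu)
    (by simp) (h.normal_ne_zero hu) (h.inner_pd_normal hu) (fun l => ?_) ?_)
  · rw [inner_sub_right, h.inner_pd_pd_pd hu, inner_add_right, inner_sum, inner_smul_right,
      h.inner_pd_normal hu, mul_zero, add_zero, sub_eq_zero, Matrix.mul_apply]
    refine sum_congr rfl fun k _ => ?_
    rw [inner_smul_right, mul_comm]
    rfl
  · rw [inner_sub_right, inner_add_right, inner_sum, inner_smul_right, h.inner_normal_self hu,
      mul_one, sum_eq_zero fun k _ => by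
        rw [inner_smul_right, real_inner_comm, h.inner_pd_normal hu, mul_zero],
      zero_add, real_inner_comm]
    exact sub_self _

theorem pd_secondForm_apply (h : IsLocalHypersurface φ N U) (hu : u ∈ U) (j l k : Fin n) :
    pd j (secondForm φ N) u l k = inner ℝ (pd j (pd l (pd k φ)) u) (N u)
      - ∑ m, christoffel (metric φ) m l k u * secondForm φ N u j m := by
  have hweingarten : inner ℝ (pd l (pd k φ) u) (pd j N u) =
      -∑ m, christoffel (metric φ) m l k u * secondForm φ N u j m := by
    simp only [h.gauss_formula hu l k, inner_add_left, sum_inner, real_inner_smul_left,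
      h.inner_normal_pd_normal hu, h.inner_pd_pd_normal hu, mul_zero, add_zero, mul_neg,
      sum_neg_distrib]
  rw [← pd_matrix_apply j (h.differentiableAt_secondForm hu), sub_eq_add_neg, ← hweingarten]
  exact pd_inner j (h.differentiableAt_pd_pd hu l k) (h.differentiableAt_normal hu)

theorem codazzi (h : IsLocalHypersurface φ N U) (hu : u ∈ U) (j l k : Fin n) :
    covPd j (-(christoffelMat (metric φ) u j)ᵀ) (christoffelMat (metric φ) u j)
        (secondForm φ N) u l k =
      covPd l (-(christoffelMat (metric φ) u l)ᵀ) (christoffelMat (metric φ) u l)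
        (secondForm φ N) u j k := by
  have hΓ : ∀ m, christoffel (metric φ) m j l u = christoffel (metric φ) m l j u := fun m =>
    christoffel_comm (Eventually.of_forall (metric_isSymm φ)) m j l
  simp only [covPd, Matrix.sub_apply, Matrix.add_apply, neg_mul, Matrix.neg_apply,
    Matrix.mul_apply, Matrix.transpose_apply, christoffelMat, Matrix.of_apply,
    h.pd_secondForm_apply hu, h.pd_pd_pd_comm hu j l k, hΓ, mul_comm (secondForm φ N u _ _)]
  ring

theorem isCodazziPairAt (h : IsLocalHypersurface φ N U) (hu : u ∈ U) :
    IsCodazziPairAt (christoffelMat (metric φ) u) (metric φ) (secondForm φ N) u where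
  differentiableAt_metric := h.differentiableAt_metric hu
  differentiableAt_tensor := h.differentiableAt_secondForm hu
  posDef := (h.eventually_mem hu).mono fun _ hv => h.metric_posDef hv
  isHermitian := (h.eventually_mem hu).mono fun _ hv => h.secondForm_isSymm hv
  parallel := covPd_metric_eq_zero (h.differentiableAt_metric hu)
    (Eventually.of_forall (metric_isSymm φ)) (h.isUnit_det_metric hu)
  codazzi := h.codazzi hu

theorem pd_apply (h : IsLocalHypersurface φ N U) (hu : u ∈ U) (i : Fin n) (a : Fin (n + 1)) :
    pd i (fun v => φ v a) u = pd i φ u a :=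
  pd_linearMap_apply i (EuclideanSpace.projₗ a) (h.differentiableAt hu)

theorem pd_apply_eventuallyEq (h : IsLocalHypersurface φ N U) (hu : u ∈ U) (i : Fin n)
    (a : Fin (n + 1)) : pd i (fun v => φ v a) =ᶠ[𝓝 u] fun v => pd i φ v a :=
  (h.eventually_mem hu).mono fun _ hv => h.pd_apply hv i a

theorem covHess_apply (h : IsLocalHypersurface φ N U) (hu : u ∈ U) (i j : Fin n)
    (a : Fin (n + 1)) :
    covHess (metric φ) (fun v => φ v a) i j u = secondForm φ N u i j * N u a := by
  have hpd : pd i (fun v => pd j φ v a) u = pd i (pd j φ) u a :=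
    pd_linearMap_apply i (EuclideanSpace.projₗ a) (h.differentiableAt_pd hu j)
  rw [covHess, pd_congr i (h.pd_apply_eventuallyEq hu j a), hpd, h.gauss_formula hu]
  simp [h.pd_apply hu]

theorem covHess_comm (h : IsLocalHypersurface φ N U) (hu : u ∈ U) (a : Fin (n + 1))
    (i j : Fin n) :
    covHess (metric φ) (fun v => φ v a) j i u = covHess (metric φ) (fun v => φ v a) i j u := by
  rw [h.covHess_apply hu, h.covHess_apply hu, (h.secondForm_isSymm hu).apply]

theorem sum_newtonUp_mul_covHess (h : IsLocalHypersurface φ N U) (hu : u ∈ U) (μ₀ : ℝ) (r : ℕ)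
    (a : Fin (n + 1)) :
    ∑ i, ∑ j, newtonUp μ₀ r φ N u i j * covHess (metric φ) (fun v => φ v a) i j u =
      (((r : ℝ) + 1) * wsigma μ₀ (shape φ N u) (r + 1) - μ₀ * wsigma μ₀ (shape φ N u) r)
        * N u a := by
  have hdiag : IsDiagonalizable (shape φ N u) :=
    (h.isCodazziPairAt hu).eventually_isDiagonalizable.self_of_nhds
  have htrace : (wNewton μ₀ (shape φ N u) r * shape φ N u).trace =
      ∑ i, ∑ j, newtonUp μ₀ r φ N u i j * secondForm φ N u j i := by
    rw [shape, ← mul_assoc]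
    rfl
  simp only [← hdiag.trace_wNewton_mul_self, htrace, h.covHess_apply hu, sum_mul, mul_assoc,
    (h.secondForm_isSymm hu).apply]

theorem covDivTensor_newtonUp (h : IsLocalHypersurface φ N U) (hu : u ∈ U) (μ₀ : ℝ) (r : ℕ)
    (i : Fin n) : covDivTensor (metric φ) (newtonUp μ₀ r φ N) i u = 0 :=
  (h.isCodazziPairAt hu).covDivTensor_raisedNewton μ₀ r i

theorem covDiv_newtonUp_mul_pd (h : IsLocalHypersurface φ N U) (hu : u ∈ U) (μ₀ : ℝ) (r : ℕ)
    (a : Fin (n + 1)) :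
    covDiv (metric φ) (fun v j => ∑ i, newtonUp μ₀ r φ N v i j * pd i (fun v => φ v a) v) u =
      (((r : ℝ) + 1) * wsigma μ₀ (shape φ N u) (r + 1) - μ₀ * wsigma μ₀ (shape φ N u) r)
        * N u a := by
  have hpd : ∀ i, DifferentiableAt ℝ (pd i fun v => φ v a) u := fun i =>
    ((EuclideanSpace.proj (𝕜 := ℝ) a).differentiableAt.comp u
      (h.differentiableAt_pd hu i)).congr_of_eventuallyEq (h.pd_apply_eventuallyEq hu i a)
  have hnewton : DifferentiableAt ℝ (newtonUp μ₀ r φ N) u :=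
    (h.isCodazziPairAt hu).differentiableAt_raisedNewton μ₀ r
  rw [covDiv_sum_mul_pd hnewton hpd, ← h.sum_newtonUp_mul_covHess hu]
  simp only [h.covDivTensor_newtonUp hu, zero_mul, sum_const_zero, zero_add]
  exact sum_congr rfl fun i _ => sum_congr rfl fun j _ => by rw [h.covHess_comm hu]

end IsLocalHypersurface

end LocalHypersurface

/-! ### Hypersurfaces in the charts of a manifold -/

section Manifold

variable {n : ℕ} {M : Type*} [TopologicalSpace M]
  [ChartedSpace (EuclideanSpace ℝ (Fin n)) M]
  {ψ ν : M → EuclideanSpace ℝ (Fin (n + 1))}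

namespace IsHypersurface

theorem isLocalHypersurface (hψ : IsHypersurface ψ ν)
    {e : OpenPartialHomeomorph M (EuclideanSpace ℝ (Fin n))}
    (he : e ∈ IsManifold.maximalAtlas (𝓡 n) ∞ M) :
    IsLocalHypersurface (ψ ∘ e.symm) (ν ∘ e.symm) e.target := by
  have hsymm : ContMDiffOn (𝓡 n) (𝓡 n) ∞ e.symm e.target :=
    contMDiffOn_symm_of_mem_maximalAtlas he
  have hmdiff : e.MDifferentiable (𝓡 n) (𝓡 n) :=
    ⟨(contMDiffOn_of_mem_maximalAtlas he).mdifferentiableOn (by simp),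
      hsymm.mdifferentiableOn (by simp)⟩
  have hchain : ∀ u ∈ e.target, ∀ w, fderiv ℝ (ψ ∘ e.symm) u w =
      mfderiv (𝓡 n) (𝓡 (n + 1)) ψ (e.symm u) (mfderiv (𝓡 n) (𝓡 n) e.symm u w) := by
    intro u hu w
    rw [← mfderiv_eq_fderiv, mfderiv_comp u (hψ.smooth.mdifferentiable (by simp) _)
      (hmdiff.mdifferentiableAt_symm hu)]
    rfl
  exact
    { isOpen := e.open_target
      smooth := contMDiffOn_iff_contDiffOn.mp (hψ.smooth.comp_contMDiffOn hsymm)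
      immersion := fun u hu w w' hw => by
        rw [hchain u hu, hchain u hu] at hw
        exact hmdiff.symm.mfderiv_injective hu (hψ.immersion _ hw)
      normal_smooth := contMDiffOn_iff_contDiffOn.mp (hψ.normal_smooth.comp_contMDiffOn hsymm)
      normal_unit := fun u _ => hψ.normal_unit _
      normal_orthogonal := fun u hu w => by
        rw [hchain u hu]
        exact hψ.normal_orthogonal _ _ }

theorem isSigmaMinimal_iff_solvesNewtonPDE (hψ : IsHypersurface ψ ν) (μ₀ : ℝ) (r : ℕ) :
    IsSigmaMinimal μ₀ r ψ ν ↔ ∀ a, SolvesNewtonPDE μ₀ r ψ ν fun p => ψ p a := by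
  refine ⟨fun hmin a e he u hu => ?_, fun hpde e he u hu => ?_⟩
  · exact ((hψ.isLocalHypersurface he).sum_newtonUp_mul_covHess hu μ₀ r a).trans
      (by rw [hmin e he u hu, zero_mul])
  · have hlocal := hψ.isLocalHypersurface he
    obtain ⟨a, ha⟩ := hlocal.exists_normal_apply_ne_zero hu
    have hprod := (hlocal.sum_newtonUp_mul_covHess hu μ₀ r a).symm.trans (hpde a e he u hu)
    exact (mul_eq_zero.mp hprod).resolve_right ha

theorem isSigmaMinimal_iff_solvesNewtonDivPDE (hψ : IsHypersurface ψ ν) (μ₀ : ℝ) (r : ℕ) :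
    IsSigmaMinimal μ₀ r ψ ν ↔ ∀ a, SolvesNewtonDivPDE μ₀ r ψ ν fun p => ψ p a := by
  refine ⟨fun hmin a e he u hu => ?_, fun hdiv e he u hu => ?_⟩
  · exact ((hψ.isLocalHypersurface he).covDiv_newtonUp_mul_pd hu μ₀ r a).trans
      (by rw [hmin e he u hu, zero_mul])
  · have hlocal := hψ.isLocalHypersurface he
    obtain ⟨a, ha⟩ := hlocal.exists_normal_apply_ne_zero hu
    have hprod := (hlocal.covDiv_newtonUp_mul_pd hu μ₀ r a).symm.trans (hdiv a e he u hu)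
    exact (mul_eq_zero.mp hprod).resolve_right ha

theorem newtonDivFree (hψ : IsHypersurface ψ ν) (μ₀ : ℝ) (r : ℕ) : NewtonDivFree μ₀ r ψ ν :=
  fun _ he _ hu i => (hψ.isLocalHypersurface he).covDivTensor_newtonUp hu μ₀ r i

end IsHypersurface

end Manifold

end WeightedCurvature

end

theorem mainTheorem3 {n : ℕ} {M : Type*} [TopologicalSpace M]
    [ChartedSpace (EuclideanSpace ℝ (Fin n)) M] [IsManifold (𝓡 n) ∞ M]
    (ψ ν : M → EuclideanSpace ℝ (Fin (n + 1))) (hψ : WeightedCurvature.IsHypersurface ψ ν)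
    (μ₀ : ℝ) (r : ℕ) :
    (WeightedCurvature.IsSigmaMinimal μ₀ r ψ ν ↔
      ∀ a, WeightedCurvature.SolvesNewtonPDE μ₀ r ψ ν (fun p => ψ p a)) ∧
    (WeightedCurvature.IsSigmaMinimal μ₀ r ψ ν ↔
      ∀ a, WeightedCurvature.SolvesNewtonDivPDE μ₀ r ψ ν (fun p => ψ p a)) ∧
    WeightedCurvature.NewtonDivFree μ₀ r ψ ν :=
  ⟨hψ.isSigmaMinimal_iff_solvesNewtonPDE μ₀ r, hψ.isSigmaMinimal_iff_solvesNewtonDivPDE μ₀ r,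
    hψ.newtonDivFree μ₀ r⟩
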